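/- **Setting.** Let $d\ge 1$, $2\le k\le N$, and let $X_1,\dots,X_N$ be i.i.d. random vectors in $\mathbb R^d$ whose coordinates are i.i.d. with a common law of mean $\mu=0$, variance $\sigma^2>0$, finite fourth moment and kurtosis $\kappa$ (the fourth central moment divided by $\sigma^4$). For a set $U$ of $k$ of the $N$ items put $\mu_U=\frac1k\sum_{i\in U}X_i$ and let $s(x,y)=x^\intercal y$. Given scores $S_{U,i}$ of the items $i=1,\dots,N$ relative to $U$, let $\mathrm{Precision}_k(U)$ be the fraction of $U$ among the $k$ items with the highest scores (a $k$-set maximising the total score; ties are broken uniformly, and the expectation over this draw is taken), and let $\mathrm{Consistency}_k$ be its expectation over the scores and over a uniformly drawn $k$-set $U$. The true scores are $S_{U,i}=s(X_i,\mu_U)$. **Normal approximation.** For every $k$-set $U$ replace the true scores by a jointly normal vector $(G_{U,i})_{1\le i\le N}$ with the means and variances of the true scores $(s(X_i,\mu_U))_i$ and with their covariances for every pair of distinct items not both in $U$; let the covariance of any two distinct in-set scores be a constant $c$, the same for all pairs and all $U$. Treating the in-set scores as i.i.d. means $c=0$. Let $s_{\mathrm{in},(i)}$ be the $i$-th highest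 of the in-set scores $(G_{U,a})_{a\in U}$ and $s_{\mathrm{out},(m)}$ the $m$-th highest of the out-set scores $(G_{U,a})_{a\notin U}$, with $s_{\mathrm{out},(m)}=-\infty$ if $m>N-k$. **Claim.** For every $k$-set $U$ and $1\le i\le k$: 1. almost surely, $\mathrm{Precision}_k(U)\ge \frac ik$ if and only if $s_{\mathrm{in},(i)}>s_{\mathrm{out},(k-i+1)}$; 2. the distribution function of $s_{\mathrm{out},(k-i+1)}$ is $$F_{\mathrm{out},(k-i+1)}(x)=\sum_{j=\max(0,\,N-2k+i)}^{N-k}\binom{N-k}{j}\frac{1}{2^{N-k}}\Big(1+\operatorname{erf}\frac{x}{\sqrt2\,\sigma_{\mathrm{out}}}\Big)^{j}\Big(1-\operatorname{erf}\frac{x}{\sqrt2\,\sigma_{\mathrm{out}}}\Big)^{N-k-j},\qquad \sigma_{\mathrm{out}}=\sigma^2\sqrt{d/k};$$ 3. $s_{\mathrm{in},(i)}$ has a probability density $f_{\mathrm{in},(i)}$, which does not depend on $U$; the product $f_{\mathrm{in},(i)}F_{\mathrm{out},(k-i+1)}$ is integrable; and if $c=0$, then $$f_{\mathrm{in},(i)}(x)=\frac{k!}{\sigma_{\mathrm{in}}\,2^{k-1}(k-i)!\,(i-1)!}\;\phi\Big(\frac{x-\mu_{\mathrm{in}}}{\sigma_{\mathrm{in}}}\Big)\Big(1+\operatorname{erf}\frac{x-\mu_{\mathrm{in}}}{\sqrt2\,\sigma_{\mathrm{in}}}\Big)^{k-i}\Big(1-\operatorname{erf}\frac{x-\mu_{\mathrm{in}}}{\sqrt2\,\sigma_{\mathrm{in}}}\Big)^{i-1},$$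 where $\mu_{\mathrm{in}}=d\sigma^2/k$, $\sigma_{\mathrm{in}}=\sigma^2\sqrt{d(\kappa+k-2)}/k$ and $\phi(z)=\frac{1}{\sqrt{2\pi}}e^{-z^2/2}$. Moreover, the consistency score of the approximating scores is $$\mathrm{Consistency}_k=\frac1k\sum_{i=1}^k\int_{-\infty}^{\infty}f_{\mathrm{in},(i)}(x)\,F_{\mathrm{out},(k-i+1)}(x)\,dx .$$ -/

import Mathlib

open MeasureTheory ProbabilityTheory Finset

noncomputable section

namespace AverageEmbedding

/-- The sets of `k` nearest neighbours: all `k`-element sets of items that maximise the total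
score, where `s i` is the similarity of item `i` to the query. -/
def topSets {N : ℕ} (k : ℕ) (s : Fin N → ℝ) : Finset (Finset (Fin N)) :=
  (powersetCard k univ).filter
    fun Y => ∀ Z ∈ powersetCard k (univ : Finset (Fin N)), ∑ i ∈ Z, s i ≤ ∑ i ∈ Y, s i

/-- The fraction of `U` among the `k` nearest neighbours for the scores `s`. If the set of
nearest neighbours is not unique it is drawn uniformly, so the average over all of them is taken. -/
def precision {N : ℕ} (k : ℕ) (s : Fin N → ℝ) (U : Finset (Fin N)) : ℝ :=
  (∑ Y ∈ topSets k s, (#(Y ∩ U) : ℝ) / k) / #(topSets k s)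

/-- Expected precision, over the randomness of the scores and over a uniformly drawn `k`-element
set `U` of items. `S U i` is the random similarity of item `i` to the average of `U`. -/
def consistency {Ω : Type*} [MeasurableSpace Ω] {N : ℕ} (k : ℕ)
    (S : Finset (Fin N) → Fin N → Ω → ℝ) (P : Measure Ω) : ℝ :=
  (∑ U ∈ powersetCard k (univ : Finset (Fin N)), ∫ ω, precision k (fun i => S U i ω) U ∂P)
    / #(powersetCard k (univ : Finset (Fin N)))

/-- The average of the embeddings of the items in `U`. -/
def average {N d : ℕ} (x : Fin N → EuclideanSpace ℝ (Fin d)) (U : Finset (Fin N)) :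
    EuclideanSpace ℝ (Fin d) :=
  (#U : ℝ)⁻¹ • ∑ i ∈ U, x i

/-- The inner product similarity of item `i` to the average of `U`, as a random variable.
The consistency score of the random embeddings `X` is `consistency k (similarity X) P`. -/
def similarity {Ω : Type*} {N d : ℕ} (X : Fin N → Ω → EuclideanSpace ℝ (Fin d))
    (U : Finset (Fin N)) (i : Fin N) (ω : Ω) : ℝ :=
  inner ℝ (X i ω) (average (fun j => X j ω) U)

/-- `G` is a normal approximation of the similarities to the average of `U`: a jointly normal
vector whose means, variances and covariances are those of the true similarities, except that the
covariance between any two distinct in-set similarities is a prescribed number `c`. -/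
structure IsNormalApprox {Ω Ω' : Type*} [MeasurableSpace Ω] [MeasurableSpace Ω'] {N d : ℕ}
    (X : Fin N → Ω → EuclideanSpace ℝ (Fin d)) (P : Measure Ω) (U : Finset (Fin N))
    (G : Fin N → Ω' → ℝ) (Q : Measure Ω') (c : ℝ) : Prop where
  gaussian : HasGaussianLaw (fun ω i => G i ω) Q
  mean : ∀ i, ∫ ω, G i ω ∂Q = ∫ ω, similarity X U i ω ∂P
  var : ∀ i, Var[G i; Q] = Var[similarity X U i; P]
  cov_out : ∀ i j, i ≠ j → j ∉ U → cov[G i, G j; Q] = cov[similarity X U i, similarity X U j; P]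
  cov_in : ∀ i j, i ≠ j → i ∈ U → j ∈ U → cov[G i, G j; Q] = c

/-- The `m`-th highest value (`1 ≤ m`) of the family `(s a)` for `a ∈ A`, counted with
multiplicity: the largest `t` such that at least `m` of the values are `≥ t`. It is `⊥` if the
family has fewer than `m` members. -/
def nthHighest {N : ℕ} (A : Finset (Fin N)) (s : Fin N → ℝ) (m : ℕ) : EReal :=
  ⨆ (t : ℝ) (_ : m ≤ #{a ∈ A | t ≤ s a}), (t : EReal)

/-- The Gauss error function. -/
def erf (x : ℝ) : ℝ := 2 / √Real.pi * ∫ t in (0 : ℝ)..x, Real.exp (-t ^ 2)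

/-- The standard normal density. -/
def phi (x : ℝ) : ℝ := 1 / √(2 * Real.pi) * Real.exp (-x ^ 2 / 2)

/-- The kurtosis (normalised fourth central moment) of a distribution on the line. -/
def kurtosis (ν : Measure ℝ) : ℝ := centralMoment id 4 ν / Var[id; ν] ^ 2

def muIn (d k : ℕ) (σ : ℝ) : ℝ := d * σ ^ 2 / k

def sigmaIn (d k : ℕ) (σ κ : ℝ) : ℝ := σ ^ 2 * √(d * (κ + k - 2)) / k

def sigmaOut (d k : ℕ) (σ : ℝ) : ℝ := σ ^ 2 * √(d / k)

/-- Explicit density of the `i`-th highest in-set similarity. -/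
def fIn (d k : ℕ) (σ κ : ℝ) (i : ℕ) (x : ℝ) : ℝ :=
  (k.factorial : ℝ)
      / (sigmaIn d k σ κ * 2 ^ (k - 1) * ((k - i).factorial : ℝ) * ((i - 1).factorial : ℝ))
    * phi ((x - muIn d k σ) / sigmaIn d k σ κ)
    * (1 + erf ((x - muIn d k σ) / (√2 * sigmaIn d k σ κ))) ^ (k - i)
    * (1 - erf ((x - muIn d k σ) / (√2 * sigmaIn d k σ κ))) ^ (i - 1)

/-- Explicit distribution function of the `m`-th highest of the `N - k` out-set similarities;
the sum runs over `max 0 (N - k - m + 1) ≤ j ≤ N - k`. -/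
def FOut (N d k : ℕ) (σ : ℝ) (m : ℕ) (x : ℝ) : ℝ :=
  ∑ j ∈ (range (N - k + 1)).filter (fun j => N - k < j + m),
    ((N - k).choose j : ℝ) / 2 ^ (N - k)
      * (1 + erf (x / (√2 * sigmaOut d k σ))) ^ j
      * (1 - erf (x / (√2 * sigmaOut d k σ))) ^ (N - k - j)

end AverageEmbedding

end

/-! When no in-set score equals an out-set score, a set of nearest neighbours holds at least `i`
items of `U` exactly when fewer than `k - i + 1` out-set scores reach the `i`-th highest in-set
score (`le_card_inter_iff`). Summing these indicators over `i` counts the intersection, so the mean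
precision is an average of `k` probabilities (`precision_eq_sum`). Such ties have probability zero,
because the difference of an in-set and an out-set score is a nondegenerate normal variable.

The embedding of an out-set item enters each product of its similarity once, and it is centred.
Hence out-set scores have mean zero and are uncorrelated with all other scores. Joint normality
upgrades this to independence: the out-set scores are i.i.d. and independent of the in-set block,
whatever `c` is. Each probability is therefore the integral of the out-set distribution function, a
binomial tail, against the in-set law (`measureReal_out_lt_in`).

The in-set order statistic has a density for every `c`, since its value is always one of finitely
many nondegenerate normal coordinates. Its law is the same for all `U`, since means and covariances
determine a Gaussian vector. For `c = 0` the density is the derivative of a binomial tail, which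
telescopes to a single term (`hasDerivAt_binomialTail`). -/

noncomputable section

namespace AverageEmbedding

/-! ### Order statistics as counting thresholds. -/

section OrderStatistics

variable {N : ℕ} {A : Finset (Fin N)} {s : Fin N → ℝ} {m : ℕ}

lemma nthHighest_eq_bot (h : #A < m) : nthHighest A s m = ⊥ := by
  simp only [nthHighest, iSup_eq_bot]
  intro t ht
  exact absurd (ht.trans (card_filter_le _ _)) (by omega)

/-- An admissible threshold can be raised to the least score above it without losing any item, so
only the finitely many scores matter and the supremum is attained at the largest admissible one. -/
lemma exists_nthHighest_eq (hm : 1 ≤ m) (hA : m ≤ #A) :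
    ∃ a ∈ A, nthHighest A s m = s a ∧ ∀ t, m ≤ #{b ∈ A | t ≤ s b} ↔ t ≤ s a := by
  have key : ∀ t, m ≤ #{b ∈ A | t ≤ s b} → ∃ b ∈ A, t ≤ s b ∧ m ≤ #{c ∈ A | s b ≤ s c} := by
    intro t ht
    obtain ⟨b, hb, hmin⟩ := exists_min_image {b ∈ A | t ≤ s b} s
      (card_pos.mp (by omega))
    rw [mem_filter] at hb
    refine ⟨b, hb.1, hb.2, ht.trans (card_le_card fun c hc => ?_)⟩
    exact mem_filter.2 ⟨(mem_filter.1 hc).1, hmin c hc⟩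
  obtain ⟨a₀, -, hmin⟩ := exists_min_image A s (card_pos.mp (by omega))
  obtain ⟨b₀, hb₀, -, hb₀'⟩ := key (s a₀) (by rwa [filter_true_of_mem fun c hc => hmin c hc])
  obtain ⟨a, ha, hmax⟩ := exists_max_image {b ∈ A | m ≤ #{c ∈ A | s b ≤ s c}} s
    ⟨b₀, mem_filter.2 ⟨hb₀, hb₀'⟩⟩
  rw [mem_filter] at ha
  have hiff : ∀ t, m ≤ #{b ∈ A | t ≤ s b} ↔ t ≤ s a := by
    refine fun t => ⟨fun ht => ?_, fun ht => ha.2.trans (card_le_card fun c hc => ?_)⟩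
    · obtain ⟨b, hb, htb, hb'⟩ := key t ht
      exact htb.trans (hmax b (mem_filter.2 ⟨hb, hb'⟩))
    · exact mem_filter.2 ⟨(mem_filter.1 hc).1, ht.trans (mem_filter.1 hc).2⟩
  refine ⟨a, ha.1, le_antisymm ?_ ?_, hiff⟩
  · exact iSup₂_le fun t ht => EReal.coe_le_coe_iff.2 ((hiff t).1 ht)
  · exact le_iSup₂_of_le (s a) ha.2 le_rfl

lemma coe_le_nthHighest_iff (hm : 1 ≤ m) {t : ℝ} :
    (t : EReal) ≤ nthHighest A s m ↔ m ≤ #{a ∈ A | t ≤ s a} := by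
  by_cases hA : m ≤ #A
  · obtain ⟨a, -, h, hiff⟩ := exists_nthHighest_eq (s := s) hm hA
    rw [h, hiff, EReal.coe_le_coe_iff]
  · rw [nthHighest_eq_bot (by omega)]
    have := card_filter_le A (fun a => t ≤ s a)
    simp only [le_bot_iff, EReal.coe_ne_bot, false_iff]
    omega

lemma nthHighest_le_coe_iff (hm : 1 ≤ m) {x : ℝ} :
    nthHighest A s m ≤ x ↔ #{a ∈ A | x < s a} < m := by
  by_cases hA : m ≤ #A
  · obtain ⟨a, ha, h, hiff⟩ := exists_nthHighest_eq (s := s) hm hA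
    rw [h, EReal.coe_le_coe_iff, ← not_iff_not, not_le, not_lt]
    refine ⟨fun hx => ((hiff (s a)).2 le_rfl).trans (card_le_card fun c hc => ?_), fun hx => ?_⟩
    · exact mem_filter.2 ⟨(mem_filter.1 hc).1, hx.trans_le (mem_filter.1 hc).2⟩
    · obtain ⟨b, hb, hmin⟩ := exists_min_image {b ∈ A | x < s b} s (card_pos.mp (by omega))
      refine (mem_filter.1 hb).2.trans_le ((hiff (s b)).1 (hx.trans (card_le_card fun c hc => ?_)))
      exact mem_filter.2 ⟨(mem_filter.1 hc).1, hmin c hc⟩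
  · have := card_filter_le A (fun a => x < s a)
    simp only [nthHighest_eq_bot (not_le.1 hA), bot_le, true_iff]
    omega

lemma measurable_nthHighest (A : Finset (Fin N)) (hm : 1 ≤ m) :
    Measurable fun s : Fin N → ℝ => nthHighest A s m := by
  refine measurable_of_Iic fun x => ?_
  induction x using EReal.rec with
  | top => simp
  | bot =>
    by_cases hA : m ≤ #A
    · convert MeasurableSet.empty
      ext s
      obtain ⟨a, -, h, -⟩ := exists_nthHighest_eq (s := s) hm hA
      simp [h]
    · simp [nthHighest_eq_bot (not_le.1 hA)]
  | coe x =>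
    simp only [Set.preimage, Set.mem_Iic, nthHighest_le_coe_iff hm, card_filter]
    refine measurableSet_lt (Finset.measurable_sum _ fun a _ => ?_) measurable_const
    exact Measurable.ite (measurableSet_lt measurable_const (measurable_pi_apply a))
      measurable_const measurable_const

lemma nthHighest_congr {s' : Fin N → ℝ} (h : ∀ a ∈ A, s a = s' a) :
    nthHighest A s m = nthHighest A s' m := by
  have : ∀ t : ℝ, {a ∈ A | t ≤ s a} = {a ∈ A | t ≤ s' a} := fun t =>
    filter_congr fun a ha => by rw [h a ha]
  simp only [nthHighest, this]

/-- Lets order statistics over different sets of equal size be read as one function on the same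
space `Fin n → ℝ`. -/
lemma nthHighest_eq_univ {n : ℕ} (e : Fin n ↪ Fin N) (h : univ.map e = A) :
    nthHighest A s m = nthHighest univ (s ∘ e) m := by
  have : ∀ t : ℝ, #{a ∈ A | t ≤ s a} = #{a : Fin n | t ≤ (s ∘ e) a} := fun t => by
    rw [← h, filter_map, card_map]
    rfl
  simp only [nthHighest, this]

end OrderStatistics

/-! ### Precision in terms of order statistics. -/

section Precision

variable {N k : ℕ} {s : Fin N → ℝ} {U Y : Finset (Fin N)}

lemma topSets_nonempty (hk : k ≤ N) : (topSets k s).Nonempty := by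
  obtain ⟨Y, hY, h⟩ := exists_max_image (powersetCard k (univ : Finset (Fin N)))
    (fun Y => ∑ i ∈ Y, s i) (powersetCard_nonempty.2 (by simpa))
  exact ⟨Y, mem_filter.2 ⟨hY, h⟩⟩

lemma card_of_mem_topSets (hY : Y ∈ topSets k s) : #Y = k :=
  (mem_powersetCard.1 (mem_filter.1 hY).1).2

/-- Exchange argument: swapping `b` for `a` keeps the size and cannot increase the total. -/
lemma le_of_mem_topSets (hY : Y ∈ topSets k s) {a b : Fin N} (ha : a ∉ Y) (hb : b ∈ Y) :
    s a ≤ s b := by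
  have hab : a ∉ Y.erase b := fun h => ha (mem_of_mem_erase h)
  have hcard : #(insert a (Y.erase b)) = k := by
    rw [card_insert_of_notMem hab, card_erase_add_one hb, card_of_mem_topSets hY]
  have := (mem_filter.1 hY).2 (insert a (Y.erase b)) (mem_powersetCard.2 ⟨subset_univ _, hcard⟩)
  rw [sum_insert hab, ← add_sum_erase _ _ hb] at this
  linarith

/-- If no in-set score equals an out-set score, then a set of nearest neighbours contains at least
`i` elements of `U` exactly if the `i`-th highest in-set score beats the `(k - i + 1)`-st highest
out-set score. -/
lemma le_card_inter_iff (hU : #U = k) (hY : Y ∈ topSets k s)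
    (hs : ∀ a ∈ U, ∀ b ∉ U, s a ≠ s b) {i : ℕ} (hi : i ∈ Icc 1 k) :
    i ≤ #(Y ∩ U) ↔ nthHighest Uᶜ s (k - i + 1) < nthHighest U s i := by
  rw [mem_Icc] at hi
  have hcard : #(Y ∩ U) + #(Y \ U) = k := by
    rw [card_inter_add_card_sdiff, card_of_mem_topSets hY]
  obtain ⟨a, ha, hnth, hiff⟩ := exists_nthHighest_eq (s := s) hi.1 (hU ▸ hi.2)
  rw [hnth, ← not_le, coe_le_nthHighest_iff (by omega), not_le]
  constructor
  · intro h
    by_contra! hout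
    -- Pigeonhole: `Y` has at most `k - i` items outside `U`, so it misses an out-set item scoring
    -- at least `s a`. The weakest item of `Y ∩ U` must then strictly beat `s a`, although at least
    -- `i` in-set scores reach it.
    obtain ⟨b, hb, hbY⟩ : ∃ b ∈ ({b ∈ Uᶜ | s a ≤ s b} : Finset (Fin N)), b ∉ Y \ U :=
      exists_mem_notMem_of_card_lt_card (by omega)
    rw [mem_filter, mem_compl] at hb
    have hbY' : b ∉ Y := fun h => hbY (mem_sdiff.2 ⟨h, hb.1⟩)
    obtain ⟨c, hc, hmin⟩ := exists_min_image (Y ∩ U) s (card_pos.1 (by omega))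
    rw [mem_inter] at hc
    have hbc : s b < s c := lt_of_le_of_ne (le_of_mem_topSets hY hbY' hc.1)
      (hs c hc.2 b hb.1).symm
    have : s c ≤ s a := (hiff _).1 (h.trans (card_le_card fun e he =>
      mem_filter.2 ⟨(mem_inter.1 he).2, hmin e he⟩))
    linarith
  · intro h
    by_contra! hin
    -- An in-set item scoring at least `s a` is left out, so every out-set item of `Y` reaches `s
    -- a`; there are at least `k - i + 1` of these.
    obtain ⟨c, hc, hcY⟩ : ∃ c ∈ ({b ∈ U | s a ≤ s b} : Finset (Fin N)), c ∉ Y ∩ U :=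
      exists_mem_notMem_of_card_lt_card (hin.trans_le ((hiff (s a)).2 le_rfl))
    rw [mem_filter] at hc
    have hcY' : c ∉ Y := fun h => hcY (mem_inter.2 ⟨h, hc.1⟩)
    have : #(Y \ U) ≤ #{b ∈ Uᶜ | s a ≤ s b} := card_le_card fun b hb => by
      rw [mem_sdiff] at hb
      exact mem_filter.2 ⟨mem_compl.2 hb.2, hc.2.trans (le_of_mem_topSets hY hcY' hb.1)⟩
    omega

lemma precision_eq_of_forall (hk : k ≤ N) {r : ℕ} (h : ∀ Y ∈ topSets k s, #(Y ∩ U) = r) :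
    precision k s U = r / k := by
  have : (#(topSets k s) : ℝ) ≠ 0 := by
    exact_mod_cast (card_pos.2 (topSets_nonempty hk)).ne'
  rw [precision, sum_congr rfl fun Y hY => by rw [h Y hY], sum_const, nsmul_eq_mul]
  field_simp

lemma precision_eq_sum (hU : #U = k) (hs : ∀ a ∈ U, ∀ b ∉ U, s a ≠ s b) :
    precision k s U = 1 / k * ∑ i ∈ Icc 1 k,
      if nthHighest Uᶜ s (k - i + 1) < nthHighest U s i then (1 : ℝ) else 0 := by
  have hk : k ≤ N := by simpa [hU] using card_le_univ U
  rw [sum_boole, precision_eq_of_forall hk (r := #{i ∈ Icc 1 k |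
    nthHighest Uᶜ s (k - i + 1) < nthHighest U s i})]
  · ring
  intro Y hY
  rw [filter_congr fun i hi => (le_card_inter_iff hU hY hs hi).symm]
  have hle : #(Y ∩ U) ≤ k := (card_le_card inter_subset_left).trans (card_of_mem_topSets hY).le
  -- Layer-cake count: an integer `r ≤ k` is the number of `i` in `[1, k]` with `i ≤ r`.
  have : ({i ∈ Icc 1 k | i ≤ #(Y ∩ U)} : Finset ℕ) = Icc 1 #(Y ∩ U) := by
    ext i
    simp only [mem_filter, mem_Icc]
    omega
  rw [this, Nat.card_Icc, Nat.add_sub_cancel]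

lemma le_precision_iff (hU : #U = k) (hs : ∀ a ∈ U, ∀ b ∉ U, s a ≠ s b) {i : ℕ}
    (hi : i ∈ Icc 1 k) :
    (i : ℝ) / k ≤ precision k s U ↔ nthHighest Uᶜ s (k - i + 1) < nthHighest U s i := by
  have hk : k ≤ N := by simpa [hU] using card_le_univ U
  have hk0 : (0 : ℝ) < k := by
    rw [mem_Icc] at hi
    exact_mod_cast hi.1.trans hi.2
  obtain ⟨Y, hY⟩ := topSets_nonempty (s := s) hk
  have : precision k s U = #(Y ∩ U) / k := by
    refine precision_eq_of_forall hk fun Z hZ => ?_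
    have hle : ∀ W ∈ topSets k s, #(W ∩ U) ≤ k := fun W hW =>
      (card_le_card inter_subset_left).trans (card_of_mem_topSets hW).le
    -- Ties inside `U` or inside its complement may give several top sets, but the order-statistic
    -- criterion does not mention the top set, so all of them meet `U` equally often.
    have h : ∀ i ∈ Icc 1 k, (i ≤ #(Z ∩ U) ↔ i ≤ #(Y ∩ U)) := fun i hi => by
      rw [le_card_inter_iff hU hZ hs hi, le_card_inter_iff hU hY hs hi]
    have h1 := h #(Z ∩ U)
    have h2 := h #(Y ∩ U)
    have h3 := hle Z hZ
    have h4 := hle Y hY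
    simp only [mem_Icc] at h1 h2
    omega
  rw [this, div_le_div_iff_of_pos_right hk0, Nat.cast_le, le_card_inter_iff hU hY hs hi]

end Precision

/-! ### The error function and the normal distribution function. -/

section ErrorFunction

open Filter Topology

lemma continuous_exp_neg_sq : Continuous fun t : ℝ => Real.exp (-t ^ 2) := by fun_prop

lemma hasDerivAt_erf (x : ℝ) : HasDerivAt erf (2 / √Real.pi * Real.exp (-x ^ 2)) x :=
  (intervalIntegral.integral_hasDerivAt_right (continuous_exp_neg_sq.intervalIntegrable _ _)
    (continuous_exp_neg_sq.stronglyMeasurableAtFilter _ _)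
    continuous_exp_neg_sq.continuousAt).const_mul _

lemma continuous_erf : Continuous erf :=
  continuous_iff_continuousAt.2 fun x => (hasDerivAt_erf x).continuousAt

lemma monotone_erf : Monotone erf :=
  monotone_of_hasDerivAt_nonneg hasDerivAt_erf fun x => by dsimp only [Pi.zero_apply]; positivity

lemma erf_neg (x : ℝ) : erf (-x) = -erf x := by
  have := intervalIntegral.integral_comp_neg (a := 0) (b := x) fun t => Real.exp (-t ^ 2)
  simp only [neg_sq, neg_zero] at this
  rw [erf, erf, this, intervalIntegral.integral_symm (-x) 0]
  ring

lemma tendsto_erf_atTop : Tendsto erf atTop (𝓝 1) := by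
  have hint : IntegrableOn (fun t : ℝ => Real.exp (-t ^ 2)) (Set.Ioi 0) := by
    simpa using (integrable_exp_neg_mul_sq one_pos).integrableOn
  have h := (intervalIntegral_tendsto_integral_Ioi 0 hint tendsto_id).const_mul (2 / √Real.pi)
  have hval : ∫ t in Set.Ioi (0 : ℝ), Real.exp (-t ^ 2) = √Real.pi / 2 := by
    simpa using integral_gaussian_Ioi 1
  have hpi : √Real.pi ≠ 0 := by positivity
  rw [hval, show 2 / √Real.pi * (√Real.pi / 2) = 1 by field_simp] at h
  exact h

lemma tendsto_erf_atBot : Tendsto erf atBot (𝓝 (-1)) := by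
  have h : Tendsto (fun x => -erf (-x)) atBot (𝓝 (-1)) :=
    (tendsto_erf_atTop.comp tendsto_neg_atBot_atTop).neg
  simpa only [erf_neg, neg_neg] using h

lemma erf_le_one (x : ℝ) : erf x ≤ 1 := monotone_erf.ge_of_tendsto tendsto_erf_atTop x

lemma neg_one_le_erf (x : ℝ) : -1 ≤ erf x := monotone_erf.le_of_tendsto tendsto_erf_atBot x

/-- A density with primitive `H` vanishing at `-∞` gives `(-∞, x]` the mass `H x`. -/
lemma withDensity_Iic_of_hasDerivAt {H g : ℝ → ℝ} (hH : ∀ x, HasDerivAt H (g x) x)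
    (hg : Continuous g) (hg0 : ∀ x, 0 ≤ g x) (hbot : Tendsto H atBot (𝓝 0)) (x : ℝ) :
    volume.withDensity (fun x => ENNReal.ofReal (g x)) (Set.Iic x) = ENNReal.ofReal (H x) := by
  have hint : IntegrableOn g (Set.Iic x) := by
    -- As `g` is nonnegative, its norm integrates to `H x - H y` over `(y, x]`; convergence as `y →
    -- -∞` yields integrability.
    refine integrableOn_Iic_of_intervalIntegral_norm_tendsto (H x - 0) x (l := atBot) (a := id)
      (fun y => hg.integrableOn_Ioc) tendsto_id ?_
    refine (tendsto_const_nhds.sub hbot).congr fun y => ?_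
    simp only [id, Real.norm_of_nonneg (hg0 _)]
    exact (intervalIntegral.integral_eq_sub_of_hasDerivAt (fun z _ => hH z)
      (hg.intervalIntegrable _ _)).symm
  rw [withDensity_apply _ measurableSet_Iic, ← ofReal_integral_eq_lintegral_ofReal hint
    (Eventually.of_forall hg0), integral_Iic_of_hasDerivAt_of_tendsto' (fun y _ => hH y) hint hbot,
    sub_zero]

variable {μ σ : ℝ}

/-- The distribution function of the normal law with mean `μ` and standard deviation `σ`. -/
def normalCDF (μ σ x : ℝ) : ℝ := (1 + erf ((x - μ) / (√2 * σ))) / 2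

lemma one_sub_normalCDF (x : ℝ) :
    1 - normalCDF μ σ x = (1 - erf ((x - μ) / (√2 * σ))) / 2 := by
  rw [normalCDF]
  ring

lemma normalCDF_nonneg (x : ℝ) : 0 ≤ normalCDF μ σ x := by
  have := neg_one_le_erf ((x - μ) / (√2 * σ))
  rw [normalCDF]
  linarith

lemma normalCDF_le_one (x : ℝ) : normalCDF μ σ x ≤ 1 := by
  have := erf_le_one ((x - μ) / (√2 * σ))
  rw [normalCDF]
  linarith

lemma hasDerivAt_normalCDF (hσ : 0 < σ) (x : ℝ) :
    HasDerivAt (normalCDF μ σ) (phi ((x - μ) / σ) / σ) x := by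
  have h := ((((hasDerivAt_erf _).comp x (((hasDerivAt_id x).sub_const μ).div_const
    (√2 * σ))).const_add 1).div_const 2)
  refine h.congr_deriv ?_
  simp only [phi, id]
  have h2 : √2 ^ 2 = (2 : ℝ) := Real.sq_sqrt (by norm_num)
  rw [show -((x - μ) / (√2 * σ)) ^ 2 = -((x - μ) / σ) ^ 2 / 2 by
    rw [div_pow, mul_pow, h2, div_pow]; field_simp, Real.sqrt_mul (by norm_num)]
  have : √Real.pi ≠ 0 := by positivity
  field_simp

lemma continuous_phi : Continuous phi := by
  unfold phi
  fun_prop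

lemma phi_nonneg (x : ℝ) : 0 ≤ phi x := by
  unfold phi
  positivity

lemma continuous_normalCDF : Continuous (normalCDF μ σ) := by
  have := continuous_erf
  unfold normalCDF
  fun_prop

lemma tendsto_normalCDF_atBot (hσ : 0 < σ) : Tendsto (normalCDF μ σ) atBot (𝓝 0) := by
  have h : Tendsto (fun x => (x - μ) / (√2 * σ)) atBot atBot :=
    (tendsto_atBot_add_const_right _ (-μ) tendsto_id).atBot_div_const (by positivity)
  have h' := ((tendsto_erf_atBot.comp h).const_add 1).div_const 2
  rw [add_neg_cancel, zero_div] at h'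
  exact h'

lemma gaussianReal_real_Iic (hσ : 0 < σ) (x : ℝ) :
    (gaussianReal μ (σ ^ 2).toNNReal).real (Set.Iic x) = normalCDF μ σ x := by
  have hv : (σ ^ 2).toNNReal ≠ 0 := by
    simpa using hσ.ne'
  have hpdf : gaussianPDF μ (σ ^ 2).toNNReal =
      fun x => ENNReal.ofReal (phi ((x - μ) / σ) / σ) := by
    ext x
    rw [gaussianPDF, gaussianPDFReal, phi, Real.coe_toNNReal _ (by positivity),
      Real.sqrt_mul (by positivity), Real.sqrt_sq hσ.le]
    congr 1
    rw [show -(x - μ) ^ 2 / (2 * σ ^ 2) = -((x - μ) / σ) ^ 2 / 2 by rw [div_pow]; field_simp]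
    field_simp
  have hcont : Continuous fun x => phi ((x - μ) / σ) / σ := by
    have := continuous_phi
    fun_prop
  rw [gaussianReal_of_var_ne_zero _ hv, hpdf, measureReal_def,
    withDensity_Iic_of_hasDerivAt (hasDerivAt_normalCDF hσ) hcont
      (fun x => div_nonneg (phi_nonneg _) hσ.le) (tendsto_normalCDF_atBot hσ),
    ENNReal.toReal_ofReal (normalCDF_nonneg x)]

end ErrorFunction

/-! ### Binomial tails and their derivatives. -/

section BinomialTail

/-- The probability that more than `n - m` out of `n` independent events of probability `p`
occur. -/
def binomialTail (n m : ℕ) (p : ℝ) : ℝ :=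
  ∑ j ∈ (range (n + 1)).filter (fun j => n < j + m), (n.choose j : ℝ) * p ^ j * (1 - p) ^ (n - j)

variable {n m : ℕ}

lemma binomialTail_eq_sum_bernstein (hmn : m ≤ n) (p : ℝ) :
    binomialTail n m p =
      ∑ l ∈ range m, (bernsteinPolynomial ℝ n (n - m + l + 1)).eval p := by
  refine sum_nbij' (fun j => j - (n - m + 1)) (fun l => n - m + l + 1) ?_ ?_ ?_ ?_ ?_ <;>
    simp only [mem_filter, mem_range]
  · omega
  · omega
  · omega
  · omega
  · intro j hj
    rw [show n - m + (j - (n - m + 1)) + 1 = j by omega]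
    simp [bernsteinPolynomial]

/-- The derivative of a Bernstein polynomial of degree `n` is `n` times a difference of consecutive
ones of degree `n - 1`. The tail sum telescopes, leaving only the lower end, of index `n - m`. -/
lemma hasDerivAt_binomialTail (hm : 1 ≤ m) (hmn : m ≤ n) (p : ℝ) :
    HasDerivAt (binomialTail n m)
      ((n.factorial : ℝ) / ((n - m).factorial * (m - 1).factorial)
        * p ^ (n - m) * (1 - p) ^ (m - 1)) p := by
  rw [funext (binomialTail_eq_sum_bernstein hmn)]
  refine (HasDerivAt.fun_sum fun l _ => Polynomial.hasDerivAt _ p).congr_deriv ?_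
  simp only [bernsteinPolynomial.derivative_succ, Polynomial.eval_mul, Polynomial.eval_sub,
    Polynomial.eval_natCast, ← mul_sum]
  have := sum_range_sub' (fun l => (bernsteinPolynomial ℝ (n - 1) (n - m + l)).eval p) m
  simp only [← add_assoc] at this
  -- The upper end has index `n`, beyond the degree `n - 1`, so it vanishes.
  rw [this, bernsteinPolynomial.eq_zero_of_lt ℝ (show n - 1 < n - m + m by omega)]
  simp only [bernsteinPolynomial, add_zero, Polynomial.eval_mul, Polynomial.eval_natCast,
    Polynomial.eval_pow, Polynomial.eval_X, Polynomial.eval_sub, Polynomial.eval_one,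
    Polynomial.eval_zero, sub_zero]
  rw [Nat.cast_choose ℝ (show n - m ≤ n - 1 by omega), show n - 1 - (n - m) = m - 1 by omega]
  rw [← Nat.mul_factorial_pred (show n ≠ 0 by omega)]
  push_cast
  ring

lemma binomialTail_zero (hm : m ≤ n) : binomialTail n m 0 = 0 := by
  rw [binomialTail_eq_sum_bernstein hm]
  exact sum_eq_zero fun l _ => by simp [bernsteinPolynomial.eval_at_0]

lemma continuous_binomialTail : Continuous (binomialTail n m) := by
  unfold binomialTail
  fun_prop

lemma FOut_eq_binomialTail {N d k : ℕ} {σ : ℝ} (m : ℕ) (x : ℝ) :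
    FOut N d k σ m x = binomialTail (N - k) m (normalCDF 0 (sigmaOut d k σ) x) := by
  refine sum_congr rfl fun j hj => ?_
  have hj : j ≤ N - k := Nat.lt_succ_iff.1 (mem_range.1 (mem_filter.1 hj).1)
  -- Writing `N - k` as `j + (N - k - j)` distributes the power of two over the two factors.
  rw [one_sub_normalCDF, normalCDF, sub_zero, div_pow, div_pow, ← Nat.add_sub_cancel' hj, pow_add,
    Nat.add_sub_cancel' hj]
  field_simp

lemma continuous_FOut {N d k : ℕ} {σ : ℝ} (m : ℕ) : Continuous (FOut N d k σ m) := by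
  rw [funext (FOut_eq_binomialTail m)]
  exact continuous_binomialTail.comp continuous_normalCDF

variable {d k i : ℕ} {σ κ : ℝ}

lemma hasDerivAt_binomialTail_normalCDF (hσ : 0 < sigmaIn d k σ κ) (hi : 1 ≤ i) (hik : i ≤ k)
    (x : ℝ) :
    HasDerivAt (fun x => binomialTail k i (normalCDF (muIn d k σ) (sigmaIn d k σ κ) x))
      (fIn d k σ κ i x) x := by
  refine ((hasDerivAt_binomialTail hi hik _).comp x (hasDerivAt_normalCDF hσ x)).congr_deriv ?_
  rw [one_sub_normalCDF, normalCDF, fIn, div_pow, div_pow,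
    show k - 1 = k - i + (i - 1) by omega, pow_add]
  field_simp

lemma continuous_fIn : Continuous (fIn d k σ κ i) := by
  have := continuous_erf
  have := continuous_phi
  unfold fIn
  fun_prop

lemma fIn_nonneg (hσ : 0 < sigmaIn d k σ κ) (x : ℝ) : 0 ≤ fIn d k σ κ i x := by
  have h1 := neg_one_le_erf ((x - muIn d k σ) / (√2 * sigmaIn d k σ κ))
  have h2 := erf_le_one ((x - muIn d k σ) / (√2 * sigmaIn d k σ κ))
  have h3 := phi_nonneg ((x - muIn d k σ) / sigmaIn d k σ κ)
  exact mul_nonneg (mul_nonneg (mul_nonneg (by positivity) h3) (pow_nonneg (by linarith) _))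
    (pow_nonneg (by linarith) _)

lemma withDensity_fIn_Iic (hσ : 0 < sigmaIn d k σ κ) (hi : 1 ≤ i) (hik : i ≤ k) (x : ℝ) :
    volume.withDensity (fun x => ENNReal.ofReal (fIn d k σ κ i x)) (Set.Iic x) =
      ENNReal.ofReal (binomialTail k i (normalCDF (muIn d k σ) (sigmaIn d k σ κ) x)) := by
  refine withDensity_Iic_of_hasDerivAt (H := fun x => binomialTail k i
    (normalCDF (muIn d k σ) (sigmaIn d k σ κ) x))
    (hasDerivAt_binomialTail_normalCDF hσ hi hik) continuous_fIn
    (fIn_nonneg hσ) ?_ x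
  have h := (continuous_binomialTail (n := k) (m := i)).tendsto 0
  rw [binomialTail_zero hik] at h
  exact h.comp (tendsto_normalCDF_atBot hσ)

end BinomialTail

/-! ### Order statistics of an i.i.d. family. -/

section OrderStatisticLaw

variable {Ω : Type*} [MeasurableSpace Ω] {Q : Measure Ω} {N : ℕ}
  {G : Fin N → Ω → ℝ} {A : Finset (Fin N)} {p x : ℝ}

lemma nullMeasurableSet_filter_le_eq (hG : ∀ a ∈ A, AEMeasurable (G a) Q) (x : ℝ)
    (B : Finset (Fin N)) : NullMeasurableSet {ω | {a ∈ A | G a ω ≤ x} = B} Q := by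
  have : {ω | {a ∈ A | G a ω ≤ x} = B} =
      ⋂ a : Fin N, {ω | (a ∈ A ∧ G a ω ≤ x) ↔ a ∈ B} := by
    ext ω
    simp [Finset.ext_iff]
  rw [this]
  refine NullMeasurableSet.iInter fun a => ?_
  by_cases ha : a ∈ A
  · have hle : NullMeasurableSet {ω | G a ω ≤ x} Q := nullMeasurableSet_le (hG a ha) (by fun_prop)
    by_cases hB : a ∈ B
    · simpa [ha, hB] using hle
    · have hset : {ω | (a ∈ A ∧ G a ω ≤ x) ↔ a ∈ B} = {ω | G a ω ≤ x}ᶜ := by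
        ext ω
        simp [ha, hB]
      exact hset ▸ hle.compl
  · by_cases hB : a ∈ B <;> simp [ha, hB]

lemma measureReal_filter_le_eq [IsProbabilityMeasure Q] (hG : ∀ a ∈ A, AEMeasurable (G a) Q)
    (hind : iIndepFun (fun a : A => G a) Q) (hp : ∀ a ∈ A, Q.real {ω | G a ω ≤ x} = p)
    {B : Finset (Fin N)} (hB : B ⊆ A) :
    Q.real {ω | {a ∈ A | G a ω ≤ x} = B} = p ^ #B * (1 - p) ^ (#A - #B) := by
  classical
  have hset : {ω | {a ∈ A | G a ω ≤ x} = B} = ⋂ a ∈ (univ : Finset A),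
      G a ⁻¹' (if (a : Fin N) ∈ B then Set.Iic x else Set.Ioi x) := by
    ext ω
    simp only [Set.mem_ofPred_eq, Finset.ext_iff, mem_filter, mem_univ, Set.iInter_true,
      Set.mem_iInter, Set.mem_preimage, Subtype.forall]
    refine forall_congr' fun a => ?_
    by_cases ha : a ∈ A
    · by_cases haB : a ∈ B <;> simp [ha, haB]
    · simpa [ha] using fun h => ha (hB h)
  have hfac : ∀ a ∈ A, Q.real (G a ⁻¹' (if a ∈ B then Set.Iic x else Set.Ioi x)) =
      if a ∈ B then p else 1 - p := by
    intro a ha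
    split_ifs
    · exact hp a ha
    · rw [← hp a ha, ← probReal_compl_eq_one_sub₀
        (nullMeasurableSet_le (hG a ha) (by fun_prop))]
      congr 1
      ext ω
      simp
  rw [measureReal_def, hset, hind.measure_inter_preimage_eq_mul univ (sets := fun a : A =>
    if (a : Fin N) ∈ B then Set.Iic x else Set.Ioi x)
    fun a _ => by split_ifs <;> measurability, ENNReal.toReal_prod]
  change ∏ a : A, Q.real (G a ⁻¹' (if (a : Fin N) ∈ B then Set.Iic x else Set.Ioi x)) = _
  rw [prod_coe_sort A (fun a => Q.real (G a ⁻¹' (if a ∈ B then Set.Iic x else Set.Ioi x))),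
    prod_congr rfl hfac, prod_ite, prod_const, prod_const, filter_mem_eq_inter,
    inter_eq_right.2 hB, ← sdiff_eq_filter, card_sdiff_of_subset hB]

/-- The distribution function of an order statistic of independent random variables with common
distribution function. -/
lemma measureReal_nthHighest_le [IsProbabilityMeasure Q] (hG : ∀ a ∈ A, AEMeasurable (G a) Q)
    (hind : iIndepFun (fun a : A => G a) Q) (hp : ∀ a ∈ A, Q.real {ω | G a ω ≤ x} = p)
    {m : ℕ} (hm : 1 ≤ m) :
    Q.real {ω | nthHighest A (fun a => G a ω) m ≤ x} = binomialTail #A m p := by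
  -- Fewer than `m` values exceed `x` iff more than `#A - m` are at most `x`. Partition by the exact
  -- set `B` of the latter; its probability depends only on `#B`, whence the binomial coefficients.
  have hset : {ω | nthHighest A (fun a => G a ω) m ≤ x} =
      ⋃ B ∈ A.powerset.filter (fun B => #A < #B + m), {ω | {a ∈ A | G a ω ≤ x} = B} := by
    ext ω
    have := card_filter_add_card_filter_not (s := A) (fun a => G a ω ≤ x)
    simp only [not_le] at this
    simp only [Set.mem_ofPred_eq, nthHighest_le_coe_iff hm, Set.mem_iUnion, mem_filter,
      mem_powerset, exists_prop, exists_eq_right', filter_subset, true_and]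
    omega
  rw [measureReal_def, hset, measure_biUnion_finset₀
    (fun B _ B' _ h => (Set.disjoint_left.2 fun ω hω hω' =>
      h (hω.symm.trans hω')).aedisjoint)
    fun B _ => nullMeasurableSet_filter_le_eq hG x B,
    ENNReal.toReal_sum fun B _ => measure_ne_top _ _]
  change ∑ B ∈ A.powerset.filter (fun B => #A < #B + m), Q.real {ω | {a ∈ A | G a ω ≤ x} = B} = _
  rw [sum_congr rfl fun B hB => measureReal_filter_le_eq hG hind hp
    (mem_powerset.1 (mem_filter.1 hB).1), sum_filter,
    sum_powerset_apply_card (fun j => if #A < j + m then p ^ j * (1 - p) ^ (#A - j) else 0),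
    binomialTail, sum_filter]
  refine sum_congr rfl fun j _ => ?_
  split_ifs <;> simp [mul_assoc]

end OrderStatisticLaw

/-! ### Gaussian vectors with an independent out-set block. -/

section GaussianVectors

variable {Ω Ω' : Type*} [MeasurableSpace Ω] [MeasurableSpace Ω'] {Q : Measure Ω}
  {Q' : Measure Ω'}

/-- The law of a Gaussian vector is determined by its means and covariances. -/
lemma map_eq_map_of_hasGaussianLaw {ι : Type*} [Fintype ι] {X : ι → Ω → ℝ} {Y : ι → Ω' → ℝ}
    (hX : HasGaussianLaw (fun ω i => X i ω) Q) (hY : HasGaussianLaw (fun ω i => Y i ω) Q')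
    (hmean : ∀ i, ∫ ω, X i ω ∂Q = ∫ ω, Y i ω ∂Q')
    (hcov : ∀ i j, cov[X i, X j; Q] = cov[Y i, Y j; Q']) :
    Q.map (fun ω i => X i ω) = Q'.map (fun ω i => Y i ω) := by
  classical
  have := hX.isProbabilityMeasure
  have := hY.isProbabilityMeasure
  have := hX.isGaussian_map
  have := hY.isGaussian_map
  refine Measure.ext_of_charFunDual (funext fun L => ?_)
  obtain ⟨a, hL⟩ : ∃ a : ι → ℝ, ∀ y : ι → ℝ, L y = ∑ i, a i * y i := by
    refine ⟨fun i => L (Pi.single i 1), fun y => ?_⟩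
    conv_lhs => rw [← univ_sum_single y]
    rw [map_sum]
    refine sum_congr rfl fun i _ => ?_
    rw [show Pi.single i (y i) = y i • (Pi.single i 1 : ι → ℝ) by
      rw [← Pi.single_smul, smul_eq_mul, mul_one], map_smul, smul_eq_mul, mul_comm]
  have hXi := fun i => hX.eval i
  have hYi := fun i => hY.eval i
  -- The characteristic function at `L` depends only on the mean and variance of `L` applied to the
  -- vector; these expand into the given means and covariances.
  rw [hX.charFunDual_map_eq_fun, hY.charFunDual_map_eq_fun]
  simp only [hL]
  rw [integral_finsetSum _ fun i _ => (hXi i).integrable.const_mul _,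
    integral_finsetSum _ fun i _ => (hYi i).integrable.const_mul _,
    variance_fun_sum fun i => (hXi i).memLp_two.const_mul _,
    variance_fun_sum fun i => (hYi i).memLp_two.const_mul _]
  have hcovX : ∀ i j, cov[fun ω => a i * X i ω, fun ω => a j * X j ω; Q]
      = cov[fun ω => a i * Y i ω, fun ω => a j * Y j ω; Q'] := by
    intro i j
    rw [covariance_const_mul_left, covariance_const_mul_right, covariance_const_mul_left,
      covariance_const_mul_right, hcov]
  simp only [integral_const_mul, hmean, hcovX]

/-- A Gaussian vector with constant means and variances inside and outside `U`, whose coordinates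
outside `U` are uncorrelated with all others. -/
structure IsBlockGaussian {N : ℕ} (U : Finset (Fin N)) (G : Fin N → Ω → ℝ) (Q : Measure Ω)
    (μ τ ρ c : ℝ) : Prop where
  gaussian : HasGaussianLaw (fun ω i => G i ω) Q
  mean_in : ∀ i ∈ U, ∫ ω, G i ω ∂Q = μ
  mean_out : ∀ i ∉ U, ∫ ω, G i ω ∂Q = 0
  var_in : ∀ i ∈ U, Var[G i; Q] = τ ^ 2
  var_out : ∀ i ∉ U, Var[G i; Q] = ρ ^ 2
  cov_out : ∀ i j, i ≠ j → j ∉ U → cov[G i, G j; Q] = 0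
  cov_in : ∀ i j, i ≠ j → i ∈ U → j ∈ U → cov[G i, G j; Q] = c

namespace IsBlockGaussian

variable {N : ℕ} {U : Finset (Fin N)} {G : Fin N → Ω → ℝ} {μ τ ρ c : ℝ}

lemma aemeasurable (h : IsBlockGaussian U G Q μ τ ρ c) (i : Fin N) : AEMeasurable (G i) Q :=
  (h.gaussian.eval i).aemeasurable

lemma map_in (h : IsBlockGaussian U G Q μ τ ρ c) {i : Fin N} (hi : i ∈ U) :
    Q.map (G i) = gaussianReal μ (τ ^ 2).toNNReal := by
  rw [(h.gaussian.eval i).map_eq_gaussianReal, h.mean_in i hi, h.var_in i hi]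

lemma map_out (h : IsBlockGaussian U G Q μ τ ρ c) {i : Fin N} (hi : i ∉ U) :
    Q.map (G i) = gaussianReal 0 (ρ ^ 2).toNNReal := by
  rw [(h.gaussian.eval i).map_eq_gaussianReal, h.mean_out i hi, h.var_out i hi]

/-- The difference is normal with variance `τ ^ 2 + ρ ^ 2 > 0`, hence has no atoms. Ties within `U`
are not excluded: `c = τ ^ 2` forces them. -/
lemma ae_ne (h : IsBlockGaussian U G Q μ τ ρ c) (hτ : 0 < τ) :
    ∀ᵐ ω ∂Q, ∀ a ∈ U, ∀ b ∉ U, G a ω ≠ G b ω := by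
  have := h.gaussian.isProbabilityMeasure
  refine ae_all_iff.2 fun a => ae_all_iff.2 fun ha => ae_all_iff.2 fun b => ae_all_iff.2 fun hb => ?_
  have hgauss : HasGaussianLaw (fun ω => G a ω - G b ω) Q := (h.gaussian.prodMk a b).fun_sub
  have hmap := hgauss.map_eq_gaussianReal
  rw [variance_fun_sub (h.gaussian.eval a).memLp_two (h.gaussian.eval b).memLp_two,
    h.var_in a ha, h.var_out b hb, h.cov_out a b (fun e => hb (e ▸ ha)) hb] at hmap
  have hv : (τ ^ 2 - 2 * 0 + ρ ^ 2).toNNReal ≠ 0 := by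
    rw [Ne, Real.toNNReal_eq_zero, not_le, mul_zero, sub_zero]
    positivity
  have hatoms := nullSingletonClass_gaussianReal (μ := ∫ ω, G a ω - G b ω ∂Q) hv
  have hzero : Q ((fun ω => G a ω - G b ω) ⁻¹' {0}) = 0 := by
    rw [← Measure.map_apply_of_aemeasurable hgauss.aemeasurable (measurableSet_singleton 0), hmap]
    exact measure_singleton 0
  filter_upwards [measure_eq_zero_iff_ae_notMem.1 hzero] with ω hω heq
  exact hω (by simp [heq])

lemma restrict (h : IsBlockGaussian U G Q μ τ ρ c) (A : Finset (Fin N)) :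
    HasGaussianLaw (fun ω (a : A) => G a ω) Q :=
  h.gaussian.map_fun (ContinuousLinearMap.pi fun a : A => ContinuousLinearMap.proj (a : Fin N))

lemma measureReal_out_le (h : IsBlockGaussian U G Q μ τ ρ c) (hρ : 0 < ρ) {m : ℕ} (hm : 1 ≤ m)
    (x : ℝ) :
    Q.real {ω | nthHighest Uᶜ (fun a => G a ω) m ≤ x} =
      binomialTail #Uᶜ m (normalCDF 0 ρ x) := by
  have := h.gaussian.isProbabilityMeasure
  refine measureReal_nthHighest_le (fun a _ => h.aemeasurable a)
    ((h.restrict Uᶜ).iIndepFun_of_covariance_eq_zero fun i j hij => ?_) (fun a ha => ?_) hm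
  · exact h.cov_out i j (fun e => hij (Subtype.ext e)) (mem_compl.1 j.2)
  · rw [← gaussianReal_real_Iic hρ, ← h.map_out (mem_compl.1 ha),
      map_measureReal_apply_of_aemeasurable (h.aemeasurable a) measurableSet_Iic]
    rfl

lemma measureReal_in_le (h : IsBlockGaussian U G Q μ τ ρ 0) (hτ : 0 < τ) {m : ℕ} (hm : 1 ≤ m)
    (x : ℝ) :
    Q.real {ω | nthHighest U (fun a => G a ω) m ≤ x} =
      binomialTail #U m (normalCDF μ τ x) := by
  have := h.gaussian.isProbabilityMeasure
  refine measureReal_nthHighest_le (fun a _ => h.aemeasurable a)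
    ((h.restrict U).iIndepFun_of_covariance_eq_zero fun i j hij => ?_) (fun a ha => ?_) hm
  · exact h.cov_in i j (fun e => hij (Subtype.ext e)) i.2 j.2
  · rw [← gaussianReal_real_Iic hτ, ← h.map_in ha,
      map_measureReal_apply_of_aemeasurable (h.aemeasurable a) measurableSet_Iic]
    rfl

lemma aemeasurable_nthHighest (h : IsBlockGaussian U G Q μ τ ρ c) (A : Finset (Fin N)) {m : ℕ}
    (hm : 1 ≤ m) : AEMeasurable (fun ω => nthHighest A (fun a => G a ω) m) Q :=
  (measurable_nthHighest A hm).comp_aemeasurable h.gaussian.aemeasurable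

lemma aemeasurable_toReal_nthHighest (h : IsBlockGaussian U G Q μ τ ρ c) (A : Finset (Fin N))
    {m : ℕ} (hm : 1 ≤ m) : AEMeasurable (fun ω => (nthHighest A (fun a => G a ω) m).toReal) Q :=
  measurable_ereal_toReal.comp_aemeasurable (h.aemeasurable_nthHighest A hm)

/-- The order statistic lies in a null set only if some coordinate does, and each coordinate is a
nondegenerate normal. No joint density is needed, so singular covariance matrices are allowed. -/
lemma map_in_absolutelyContinuous (h : IsBlockGaussian U G Q μ τ ρ c) (hτ : 0 < τ) {i : ℕ}
    (hi : 1 ≤ i) (hiU : i ≤ #U) :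
    Q.map (fun ω => (nthHighest U (fun a => G a ω) i).toReal) ≪ volume := by
  refine Measure.AbsolutelyContinuous.mk fun S hS hS0 => ?_
  rw [Measure.map_apply_of_aemeasurable (h.aemeasurable_toReal_nthHighest U hi) hS]
  refine measure_mono_null (t := ⋃ a ∈ U, G a ⁻¹' S) (fun ω hω => ?_)
    ((measure_biUnion_null_iff U.countable_toSet).2 fun a ha => ?_)
  · obtain ⟨a, ha, hnth, -⟩ := exists_nthHighest_eq (s := fun a => G a ω) hi hiU
    refine Set.mem_biUnion ha ?_
    rwa [Set.mem_preimage, hnth, EReal.toReal_coe] at hω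
  · rw [← Measure.map_apply_of_aemeasurable (h.aemeasurable a) hS, h.map_in ha]
    exact gaussianReal_absolutelyContinuous _ (by simpa using hτ.ne') hS0

/-- Enumerated in any order, the in-set block has a law fixed by `μ`, `τ`, `c` and its size. -/
lemma map_in_eq {U' : Finset (Fin N)} {G' : Fin N → Ω' → ℝ}
    (h : IsBlockGaussian U G Q μ τ ρ c) (h' : IsBlockGaussian U' G' Q' μ τ ρ c)
    (hU : #U = #U') {i : ℕ} (hi : 1 ≤ i) :
    Q.map (fun ω => (nthHighest U (fun a => G a ω) i).toReal) =
      Q'.map (fun ω => (nthHighest U' (fun a => G' a ω) i).toReal) := by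
  let e := (U.orderEmbOfFin rfl).toEmbedding
  let e' := (U'.orderEmbOfFin hU.symm).toEmbedding
  have he : ∀ j, e j ∈ U := U.orderEmbOfFin_mem rfl
  have he' : ∀ j, e' j ∈ U' := U'.orderEmbOfFin_mem hU.symm
  have hX : HasGaussianLaw (fun ω j => G (e j) ω) Q :=
    h.gaussian.map_fun (ContinuousLinearMap.pi fun j => ContinuousLinearMap.proj (e j))
  have hY : HasGaussianLaw (fun ω j => G' (e' j) ω) Q' :=
    h'.gaussian.map_fun (ContinuousLinearMap.pi fun j => ContinuousLinearMap.proj (e' j))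
  have hmap := map_eq_map_of_hasGaussianLaw (X := fun j => G (e j)) (Y := fun j => G' (e' j))
    hX hY (fun j => by rw [h.mean_in _ (he j), h'.mean_in _ (he' j)]) (fun j l => by
      by_cases hjl : j = l
      · rw [hjl, covariance_self (h.aemeasurable _), covariance_self (h'.aemeasurable _),
          h.var_in _ (he l), h'.var_in _ (he' l)]
      · rw [h.cov_in _ _ (e.injective.ne hjl) (he j) (he l),
          h'.cov_in _ _ (e'.injective.ne hjl) (he' j) (he' l)])
  have hT : Measurable fun y : Fin #U → ℝ => (nthHighest univ y i).toReal :=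
    measurable_ereal_toReal.comp (measurable_nthHighest univ hi)
  have hcomp := congrArg (Measure.map fun y : Fin #U → ℝ => (nthHighest univ y i).toReal) hmap
  rw [AEMeasurable.map_map_of_aemeasurable hT.aemeasurable hX.aemeasurable,
    AEMeasurable.map_map_of_aemeasurable hT.aemeasurable hY.aemeasurable] at hcomp
  convert hcomp using 3 with ω ω
  · exact congrArg EReal.toReal <| nthHighest_eq_univ e (A := U) (by simp [e])
  · exact congrArg EReal.toReal <| nthHighest_eq_univ e' (A := U') (by simp [e'])

/-- Extension by zero of a function on `A`. -/
def extendZero (A : Finset (Fin N)) (y : A → ℝ) (a : Fin N) : ℝ :=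
  if h : a ∈ A then y ⟨a, h⟩ else 0

lemma measurable_extendZero (A : Finset (Fin N)) : Measurable (extendZero A) := by
  refine measurable_pi_lambda _ fun a => ?_
  by_cases h : a ∈ A
  · simpa [extendZero, h] using measurable_pi_apply _
  · simp [extendZero, h]

lemma indepFun_nthHighest (h : IsBlockGaussian U G Q μ τ ρ c) {i m : ℕ} (hi : 1 ≤ i) (hm : 1 ≤ m) :
    IndepFun (fun ω => (nthHighest U (fun a => G a ω) i).toReal)
      (fun ω => nthHighest Uᶜ (fun a => G a ω) m) Q := by
  have hpair : HasGaussianLaw (fun ω => ((fun a : U => G a ω), fun a : ↥Uᶜ => G a ω)) Q :=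
    h.gaussian.map_fun
      ((ContinuousLinearMap.pi fun a : U => ContinuousLinearMap.proj (a : Fin N)).prod
        (ContinuousLinearMap.pi fun a : ↥Uᶜ => ContinuousLinearMap.proj (a : Fin N)))
  have hind : IndepFun (fun ω (a : U) => G a ω) (fun ω (a : ↥Uᶜ) => G a ω) Q :=
    hpair.indepFun_of_covariance_eval (X := fun a : U => G a) (Y := fun a : ↥Uᶜ => G a)
      fun a b => h.cov_out a b (fun e => mem_compl.1 b.2 (e ▸ a.2)) (mem_compl.1 b.2)
  -- An order statistic over `A` reads only coordinates in `A`, so it factors through the restricted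
  -- vector and inherits the independence of the blocks.
  have hcongr : ∀ (A : Finset (Fin N)) (j : ℕ) ω, nthHighest A (fun a => G a ω) j =
      nthHighest A (extendZero A fun a : A => G a ω) j := fun A j ω =>
    nthHighest_congr fun a ha => by simp [extendZero, ha]
  simp only [hcongr]
  exact hind.comp (measurable_ereal_toReal.comp ((measurable_nthHighest U hi).comp
    (measurable_extendZero U))) ((measurable_nthHighest Uᶜ hm).comp (measurable_extendZero Uᶜ))

/-- Absence of ties replaces `<` by `≤`; Fubini on the product law then integrates the out-set
distribution function over the in-set value. -/
lemma measureReal_out_lt_in (h : IsBlockGaussian U G Q μ τ ρ c) (hτ : 0 < τ) (hρ : 0 < ρ)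
    {i m : ℕ} (hi : 1 ≤ i) (hiU : i ≤ #U) (hm : 1 ≤ m) :
    Q.real {ω | nthHighest Uᶜ (fun a => G a ω) m < nthHighest U (fun a => G a ω) i} =
      ∫ x, binomialTail #Uᶜ m (normalCDF 0 ρ x)
        ∂(Q.map fun ω => (nthHighest U (fun a => G a ω) i).toReal) := by
  have := h.gaussian.isProbabilityMeasure
  have hin := h.aemeasurable_toReal_nthHighest U hi
  have hout := h.aemeasurable_nthHighest Uᶜ hm
  have hae : {ω | nthHighest Uᶜ (fun a => G a ω) m < nthHighest U (fun a => G a ω) i} =ᵐ[Q]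
      (fun ω => ((nthHighest U (fun a => G a ω) i).toReal, nthHighest Uᶜ (fun a => G a ω) m)) ⁻¹'
        {z : ℝ × EReal | z.2 ≤ z.1} := by
    filter_upwards [h.ae_ne hτ] with ω hω
    obtain ⟨a, ha, hnth, -⟩ := exists_nthHighest_eq (s := fun a => G a ω) hi hiU
    refine propext (show nthHighest Uᶜ (fun a => G a ω) m < nthHighest U (fun a => G a ω) i ↔
      nthHighest Uᶜ (fun a => G a ω) m ≤ ((nthHighest U (fun a => G a ω) i).toReal : EReal) from ?_)
    rw [hnth, EReal.toReal_coe, lt_iff_le_and_ne, and_iff_left_iff_imp]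
    intro _ heq
    -- With fewer than `m` out-set items the out-set value is `⊥`, which equals no real number.
    by_cases hcard : m ≤ #Uᶜ
    · obtain ⟨b, hb, hnth', -⟩ := exists_nthHighest_eq (s := fun a => G a ω) hm hcard
      rw [hnth', EReal.coe_eq_coe_iff] at heq
      exact hω a ha b (mem_compl.1 hb) heq.symm
    · rw [nthHighest_eq_bot (not_le.1 hcard)] at heq
      exact EReal.bot_ne_coe _ heq
  have hS : MeasurableSet {z : ℝ × EReal | z.2 ≤ z.1} :=
    measurableSet_le measurable_snd (measurable_coe_real_ereal.comp measurable_fst)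
  have : IsProbabilityMeasure (Q.map fun ω => nthHighest Uᶜ (fun a => G a ω) m) :=
    Measure.isProbabilityMeasure_map hout
  have : IsProbabilityMeasure (Q.map fun ω => (nthHighest U (fun a => G a ω) i).toReal) :=
    Measure.isProbabilityMeasure_map hin
  rw [measureReal_def, measure_congr hae, ← Measure.map_apply_of_aemeasurable
    (hin.prodMk hout) hS, (indepFun_iff_map_prod_eq_prod_map_map hin hout).1
    (h.indepFun_nthHighest hi hm), Measure.prod_apply hS, ← integral_toReal
    (measurable_measure_prodMk_left hS).aemeasurable (Filter.Eventually.of_forall fun x =>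
      measure_lt_top _ _)]
  refine integral_congr_ae (Filter.Eventually.of_forall fun x => ?_)
  dsimp only
  rw [← h.measureReal_out_le hρ hm x, Measure.map_apply_of_aemeasurable hout
    (measurable_prodMk_left hS)]
  rfl

end IsBlockGaussian

end GaussianVectors

/-! ### Means and covariances of the true similarities. -/

section Moments

lemma similarity_eq {Ω : Type*} {N d : ℕ} (X : Fin N → Ω → EuclideanSpace ℝ (Fin d))
    (U : Finset (Fin N)) (i : Fin N) :
    similarity X U i = fun ω => (#U : ℝ)⁻¹ *
      ∑ q ∈ U ×ˢ (univ : Finset (Fin d)), X i ω q.2 * X q.1 ω q.2 := by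
  ext ω
  rw [similarity, average, inner_smul_right, inner_sum, sum_product]
  simp [PiLp.inner_apply, mul_comm]

variable {Ω : Type*} [MeasurableSpace Ω] {P : Measure Ω}

lemma memLp_two_mul {f g : Ω → ℝ} (hf : MemLp f 4 P) (hg : MemLp g 4 P) :
    MemLp (fun ω => f ω * g ω) 2 P := by
  have : ENNReal.HolderTriple 4 4 2 := ENNReal.HolderTriple.of_toReal
    ⟨by norm_num, by norm_num, by norm_num⟩
  exact hg.mul' hf

/-- Independent real random variables with common law `ν` of mean zero, standard deviation `σ`
and finite fourth moment. -/
structure IsCenteredIID {ι : Type*} (Y : ι → Ω → ℝ) (P : Measure Ω) (ν : Measure ℝ) (σ : ℝ) :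
    Prop where
  indep : iIndepFun Y P
  law : ∀ p, HasLaw (Y p) ν P
  memLp_id : MemLp id 4 ν
  mean : ∫ x, x ∂ν = 0
  var : Var[id; ν] = σ ^ 2

namespace IsCenteredIID

variable {ι : Type*} {Y : ι → Ω → ℝ} {ν : Measure ℝ} {σ : ℝ}

lemma memLp (h : IsCenteredIID Y P ν σ) (p : ι) : MemLp (Y p) 4 P := by
  have := h.memLp_id
  rw [← (h.law p).map_eq] at this
  exact this.comp_of_map (h.law p).aemeasurable

lemma integral_eq_zero (h : IsCenteredIID Y P ν σ) (p : ι) : ∫ ω, Y p ω ∂P = 0 :=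
  (h.law p).integral_eq.trans h.mean

lemma integral_pow (h : IsCenteredIID Y P ν σ) (p : ι) (n : ℕ) :
    ∫ ω, Y p ω ^ n ∂P = ∫ x, x ^ n ∂ν :=
  (h.law p).integral_comp (f := fun x => x ^ n) (by fun_prop)

lemma integral_sq [IsProbabilityMeasure ν] (h : IsCenteredIID Y P ν σ) (p : ι) : ∫ ω, Y p ω * Y p ω ∂P = σ ^ 2 := by
  have := variance_eq_sub (h.memLp_id.mono_exponent (p := 2) (by norm_num))
  simp only [id, h.var, h.mean, Pi.pow_apply] at this
  simp only [← sq, h.integral_pow p 2, this]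
  ring

lemma integral_pow_four (h : IsCenteredIID Y P ν σ) (hσ : 0 < σ) (p : ι) :
    ∫ ω, Y p ω ^ 4 ∂P = kurtosis ν * σ ^ 4 := by
  rw [h.integral_pow, kurtosis, centralMoment, h.var]
  simp only [id, h.mean, Pi.pow_apply, Pi.sub_apply, sub_zero]
  field_simp

lemma integral_mul_of_ne (h : IsCenteredIID Y P ν σ) {p q : ι} (hpq : p ≠ q) :
    ∫ ω, Y p ω * Y q ω ∂P = 0 := by
  rw [(h.indep.indepFun hpq).integral_fun_mul_eq_mul_integral (h.memLp p).1 (h.memLp q).1,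
    h.integral_eq_zero, zero_mul]

/-- The centred factor `Y r` occurs once and is independent of the product of the other three, which
may coincide among themselves. -/
lemma covariance_mul_mul [IsProbabilityMeasure P] (h : IsCenteredIID Y P ν σ) {p q r s : ι} (hp : r ≠ p) (hq : r ≠ q)
    (hs : r ≠ s) :
    cov[fun ω => Y p ω * Y q ω, fun ω => Y r ω * Y s ω; P] = 0 := by
  classical
  have hind : IndepFun (Y r) (fun ω => Y p ω * Y q ω * Y s ω) P := by
    have hT := h.indep.indepFun_finset₀ {r} {p, q, s} (by simp [hp, hq, hs])
      fun i => (h.law i).aemeasurable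
    exact hT.comp (φ := fun y : ({r} : Finset ι) → ℝ => y ⟨r, by simp⟩)
      (ψ := fun y : ({p, q, s} : Finset ι) → ℝ =>
        y ⟨p, by simp⟩ * y ⟨q, by simp⟩ * y ⟨s, by simp⟩)
      (measurable_pi_apply _) (by fun_prop)
  rw [covariance_eq_sub (memLp_two_mul (h.memLp p) (h.memLp q))
    (memLp_two_mul (h.memLp r) (h.memLp s)), h.integral_mul_of_ne hs, mul_zero, sub_zero]
  have hcomm : ((fun ω => Y p ω * Y q ω) * fun ω => Y r ω * Y s ω) =
      fun ω => Y r ω * (Y p ω * Y q ω * Y s ω) := by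
    ext ω
    simp only [Pi.mul_apply]
    ring
  rw [hcomm, hind.integral_fun_mul_eq_mul_integral (h.memLp r).1
    (((h.memLp p).1.mul (h.memLp q).1).mul (h.memLp s).1), h.integral_eq_zero, zero_mul]

lemma variance_mul_of_ne [IsProbabilityMeasure P] [IsProbabilityMeasure ν] (h : IsCenteredIID Y P ν σ) {p q : ι} (hpq : p ≠ q) :
    Var[fun ω => Y p ω * Y q ω; P] = σ ^ 4 := by
  rw [variance_eq_sub (memLp_two_mul (h.memLp p) (h.memLp q)), h.integral_mul_of_ne hpq]
  have hind : IndepFun (fun ω => Y p ω * Y p ω) (fun ω => Y q ω * Y q ω) P :=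
    (h.indep.indepFun hpq).comp (φ := fun x => x * x) (ψ := fun x => x * x) (by fun_prop)
      (by fun_prop)
  have hcomm : (fun ω => Y p ω * Y q ω) ^ 2 = fun ω => Y p ω * Y p ω * (Y q ω * Y q ω) := by
    ext ω
    simp only [Pi.pow_apply]
    ring
  rw [hcomm, hind.integral_fun_mul_eq_mul_integral ((h.memLp p).1.mul (h.memLp p).1)
    ((h.memLp q).1.mul (h.memLp q).1), h.integral_sq, h.integral_sq]
  ring

lemma variance_mul_self [IsProbabilityMeasure P] [IsProbabilityMeasure ν] (h : IsCenteredIID Y P ν σ) (hσ : 0 < σ) (p : ι) :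
    Var[fun ω => Y p ω * Y p ω; P] = (kurtosis ν - 1) * σ ^ 4 := by
  rw [variance_eq_sub (memLp_two_mul (h.memLp p) (h.memLp p)), h.integral_sq]
  have hcomm : (fun ω => Y p ω * Y p ω) ^ 2 = fun ω => Y p ω ^ 4 := by
    ext ω
    simp only [Pi.pow_apply]
    ring
  rw [hcomm, h.integral_pow_four hσ]
  ring

/-- The variance of a squared coordinate is nonnegative. With `2 ≤ k` this gives `κ + k - 2 > 0`, so
the in-set variance does not vanish. -/
lemma one_le_kurtosis [IsProbabilityMeasure P] [IsProbabilityMeasure ν] (h : IsCenteredIID Y P ν σ) (hσ : 0 < σ) (p : ι) : 1 ≤ kurtosis ν := by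
  have h0 := variance_nonneg (fun ω => Y p ω * Y p ω) P
  rw [h.variance_mul_self hσ] at h0
  have := nonneg_of_mul_nonneg_left h0 (by positivity)
  linarith

variable {N d : ℕ} {Y : Fin N × Fin d → Ω → ℝ}

/-- Distinct summands of one similarity are uncorrelated. If `q` or `r` belongs to an item other
than `i`, its variable occurs only once; otherwise both summands are squares of distinct independent
coordinates. -/
lemma covariance_mul_eq_zero [IsProbabilityMeasure P] (h : IsCenteredIID Y P ν σ) (i : Fin N) {q r : Fin N × Fin d}
    (hqr : q ≠ r) :
    cov[fun ω => Y (i, q.2) ω * Y q ω, fun ω => Y (i, r.2) ω * Y r ω; P] = 0 := by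
  have hcomm : ∀ p q : Fin N × Fin d, (fun ω => Y p ω * Y q ω) = fun ω => Y q ω * Y p ω :=
    fun p q => funext fun ω => mul_comm _ _
  by_cases hr : r.1 = i
  · by_cases hq : q.1 = i
    · have hq' : (i, q.2) = q := Prod.ext hq.symm rfl
      have hr' : (i, r.2) = r := Prod.ext hr.symm rfl
      rw [hq', hr']
      exact ((h.indep.indepFun hqr).comp (φ := fun x => x * x) (ψ := fun x => x * x) (by fun_prop)
        (by fun_prop)).covariance_eq_zero (memLp_two_mul (h.memLp q) (h.memLp q))
          (memLp_two_mul (h.memLp r) (h.memLp r))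
    · rw [covariance_comm, hcomm (i, q.2) q]
      exact h.covariance_mul_mul (fun e => hq (congrArg Prod.fst e)) hqr
        (fun e => hq (congrArg Prod.fst e))
  · rw [hcomm (i, r.2) r]
    exact h.covariance_mul_mul (fun e => hr (congrArg Prod.fst e)) hqr.symm
      (fun e => hr (congrArg Prod.fst e))

variable {X : Fin N → Ω → EuclideanSpace ℝ (Fin d)} {U : Finset (Fin N)}

lemma memLp_term (h : IsCenteredIID (fun (p : Fin N × Fin d) ω => X p.1 ω p.2) P ν σ)
    (i : Fin N) (q : Fin N × Fin d) :
    MemLp (fun ω => X i ω q.2 * X q.1 ω q.2) 2 P :=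
  memLp_two_mul (h.memLp (i, q.2)) (h.memLp q)

lemma integral_similarity [IsProbabilityMeasure P] [IsProbabilityMeasure ν]
    (h : IsCenteredIID (fun (p : Fin N × Fin d) ω => X p.1 ω p.2) P ν σ) (i : Fin N) :
    ∫ ω, similarity X U i ω ∂P = if i ∈ U then muIn d #U σ else 0 := by
  have hterm : ∀ l a, ∫ ω, X i ω a * X l ω a ∂P = if l = i then σ ^ 2 else 0 := by
    intro l a
    split_ifs with hl
    · subst hl
      exact h.integral_sq (l, a)
    · exact h.integral_mul_of_ne (p := (i, a)) (q := (l, a)) fun e => hl (congrArg Prod.fst e).symm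
  rw [similarity_eq, integral_const_mul, integral_finsetSum _ fun q _ =>
    (h.memLp_term i q).integrable (by norm_num), sum_product]
  simp only [hterm, sum_const, card_univ, Fintype.card_fin, nsmul_eq_mul, ← mul_sum, sum_ite_eq']
  split_ifs
  · rw [muIn]
    ring
  · simp

lemma variance_similarity [IsProbabilityMeasure P] [IsProbabilityMeasure ν]
    (h : IsCenteredIID (fun (p : Fin N × Fin d) ω => X p.1 ω p.2) P ν σ) (hσ : 0 < σ) (i : Fin N) :
    Var[similarity X U i; P] = (#U : ℝ)⁻¹ ^ 2 *
      (d * ∑ l ∈ U, if l = i then (kurtosis ν - 1) * σ ^ 4 else σ ^ 4) := by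
  have hterm : ∀ l a, Var[fun ω => X i ω a * X l ω a; P] =
      if l = i then (kurtosis ν - 1) * σ ^ 4 else σ ^ 4 := by
    intro l a
    split_ifs with hl
    · subst hl
      exact h.variance_mul_self hσ (l, a)
    · exact h.variance_mul_of_ne (p := (i, a)) (q := (l, a)) fun e => hl (congrArg Prod.fst e).symm
  rw [similarity_eq, variance_const_mul, variance_fun_sum' fun q _ => h.memLp_term i q,
    sum_congr rfl fun q hq => (sum_eq_single_of_mem q hq fun r _ hr =>
      h.covariance_mul_eq_zero i hr.symm).trans (covariance_self (h.memLp_term i q).aemeasurable),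
    sum_product]
  simp only [hterm, sum_const, card_univ, Fintype.card_fin, nsmul_eq_mul, ← mul_sum]

lemma variance_similarity_out [IsProbabilityMeasure P] [IsProbabilityMeasure ν]
    (h : IsCenteredIID (fun (p : Fin N × Fin d) ω => X p.1 ω p.2) P ν σ) (hσ : 0 < σ)
    {i : Fin N} (hi : i ∉ U) :
    Var[similarity X U i; P] = sigmaOut d #U σ ^ 2 := by
  have hne : ∀ l ∈ U, l ≠ i := fun l hl e => hi (e ▸ hl)
  rw [h.variance_similarity hσ, sum_congr rfl fun l hl => if_neg (hne l hl), sigmaOut, mul_pow,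
    Real.sq_sqrt (by positivity), sum_const, nsmul_eq_mul]
  by_cases hU : (#U : ℝ) = 0
  · simp [hU]
  · field_simp

lemma variance_similarity_in [IsProbabilityMeasure P] [IsProbabilityMeasure ν]
    (h : IsCenteredIID (fun (p : Fin N × Fin d) ω => X p.1 ω p.2) P ν σ) (hσ : 0 < σ)
    (hκ : 0 ≤ kurtosis ν + #U - 2) {i : Fin N} (hi : i ∈ U) :
    Var[similarity X U i; P] = sigmaIn d #U σ (kurtosis ν) ^ 2 := by
  have hcard : (#(U.erase i) : ℝ) = #U - 1 := by
    rw [card_erase_of_mem hi, Nat.cast_sub (card_pos.2 ⟨i, hi⟩), Nat.cast_one]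
  rw [h.variance_similarity hσ, ← add_sum_erase _ _ hi, if_pos rfl,
    sum_congr rfl fun l hl => if_neg (ne_of_mem_erase hl), sigmaIn, div_pow, mul_pow,
    Real.sq_sqrt (by positivity), sum_const, nsmul_eq_mul, hcard]
  ring

lemma covariance_similarity [IsProbabilityMeasure P]
    (h : IsCenteredIID (fun (p : Fin N × Fin d) ω => X p.1 ω p.2) P ν σ)
    {i j : Fin N} (hij : i ≠ j) (hj : j ∉ U) :
    cov[similarity X U i, similarity X U j; P] = 0 := by
  rw [similarity_eq, similarity_eq, covariance_const_mul_left, covariance_const_mul_right,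
    covariance_fun_sum_fun_sum' (fun q _ => h.memLp_term i q) fun q _ => h.memLp_term j q,
    sum_eq_zero fun q hq => sum_eq_zero fun r hr => ?_, mul_zero, mul_zero]
  -- Since `j ∉ U`, a coordinate of item `j` never occurs among the factors coming from the average.
  have hne : ∀ r ∈ U ×ˢ (univ : Finset (Fin d)), ∀ a, (j, a) ≠ r := fun r hr a e =>
    hj (e ▸ hr |> fun hr => (mem_product.1 hr).1)
  exact h.covariance_mul_mul (p := (i, q.2)) (q := q) (r := (j, r.2)) (s := r)
    (fun e => hij (congrArg Prod.fst e).symm) (hne q hq _) (hne r hr _)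

lemma of_coordinates {X : Fin N → Ω → EuclideanSpace ℝ (Fin d)} (hν : MemLp id 4 ν)
    (hmean : ∫ x, x ∂ν = 0) (hvar : Var[id; ν] = σ ^ 2) (hX : iIndepFun X P)
    (hXcoord : ∀ i, iIndepFun (fun (j : Fin d) ω => X i ω j) P)
    (hXlaw : ∀ i j, HasLaw (fun ω => X i ω j) ν P) :
    IsCenteredIID (fun (p : Fin N × Fin d) ω => X p.1 ω p.2) P ν σ := by
  refine ⟨?_, fun p => hXlaw p.1 p.2, hν, hmean, hvar⟩
  -- The coordinates are only a.e. measurable, so independence is uncurried for measurable versions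
  -- and transferred back.
  have hae : ∀ i j, (fun ω => X i ω j) =ᵐ[P] (hXlaw i j).aemeasurable.mk :=
    fun i j => (hXlaw i j).aemeasurable.ae_eq_mk
  have hvec : iIndepFun (fun i ω j => (hXlaw i j).aemeasurable.mk _ ω) P := by
    refine (hX.comp (fun _ => WithLp.ofLp) fun _ => by fun_prop).congr fun i => ?_
    filter_upwards [ae_all_iff.2 (hae i)] with ω hω
    exact funext hω
  have hmk := iIndepFun_uncurry' (X := fun i j => (hXlaw i j).aemeasurable.mk)
    (fun i j => (hXlaw i j).aemeasurable.measurable_mk) hvec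
    fun i => (hXcoord i).congr (hae i)
  exact hmk.congr fun p => (hae p.1 p.2).symm

end IsCenteredIID

lemma IsNormalApprox.isBlockGaussian [IsProbabilityMeasure P] {Ω' : Type*} [MeasurableSpace Ω']
    {Q : Measure Ω'} {N d : ℕ} {ν : Measure ℝ} [IsProbabilityMeasure ν] {σ c : ℝ}
    {X : Fin N → Ω → EuclideanSpace ℝ (Fin d)} {U : Finset (Fin N)} {G : Fin N → Ω' → ℝ}
    (hG : IsNormalApprox X P U G Q c)
    (h : IsCenteredIID (fun (p : Fin N × Fin d) ω => X p.1 ω p.2) P ν σ) (hσ : 0 < σ)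
    (hκ : 0 ≤ kurtosis ν + #U - 2) :
    IsBlockGaussian U G Q (muIn d #U σ) (sigmaIn d #U σ (kurtosis ν)) (sigmaOut d #U σ) c where
  gaussian := hG.gaussian
  mean_in i hi := by rw [hG.mean, h.integral_similarity, if_pos hi]
  mean_out i hi := by rw [hG.mean, h.integral_similarity, if_neg hi]
  var_in i hi := by rw [hG.var, h.variance_similarity_in hσ hκ hi]
  var_out i hi := by rw [hG.var, h.variance_similarity_out hσ hi]
  cov_out i j hij hj := by rw [hG.cov_out i j hij hj, h.covariance_similarity hij hj]
  cov_in := hG.cov_in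

end Moments

/-! ### In-set densities and the expected precision. -/

section Consistency

variable {Ω : Type*} [MeasurableSpace Ω] {Q : Measure Ω} {N : ℕ} {U : Finset (Fin N)}
  {G : Fin N → Ω → ℝ}

namespace IsBlockGaussian

lemma map_in_eq_withDensity_rnDeriv {μ τ ρ c : ℝ} (h : IsBlockGaussian U G Q μ τ ρ c) (hτ : 0 < τ)
    {i : ℕ} (hi : 1 ≤ i) (hiU : i ≤ #U) :
    Q.map (fun ω => (nthHighest U (fun a => G a ω) i).toReal) =
      volume.withDensity fun x => ENNReal.ofReal
        ((Q.map fun ω => (nthHighest U (fun a => G a ω) i).toReal).rnDeriv volume x).toReal := by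
  have := h.gaussian.isProbabilityMeasure
  have : IsProbabilityMeasure (Q.map fun ω => (nthHighest U (fun a => G a ω) i).toReal) :=
    Measure.isProbabilityMeasure_map (h.aemeasurable_toReal_nthHighest U hi)
  conv_lhs => rw [← Measure.withDensity_rnDeriv_eq _ _ (h.map_in_absolutelyContinuous hτ hi hiU)]
  refine withDensity_congr_ae ?_
  filter_upwards [Measure.rnDeriv_lt_top
    (Q.map fun ω => (nthHighest U (fun a => G a ω) i).toReal) volume] with x hx
  exact (ENNReal.ofReal_toReal hx.ne).symm

lemma map_in_eq_withDensity_fIn {d : ℕ} {σ κ ρ : ℝ}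
    (h : IsBlockGaussian U G Q (muIn d #U σ) (sigmaIn d #U σ κ) ρ 0) (hτ : 0 < sigmaIn d #U σ κ)
    {i : ℕ} (hi : 1 ≤ i) (hiU : i ≤ #U) :
    Q.map (fun ω => (nthHighest U (fun a => G a ω) i).toReal) =
      volume.withDensity fun x => ENNReal.ofReal (fIn d #U σ κ i x) := by
  have := h.gaussian.isProbabilityMeasure
  have hin := h.aemeasurable_toReal_nthHighest U hi
  have : IsProbabilityMeasure (Q.map fun ω => (nthHighest U (fun a => G a ω) i).toReal) :=
    Measure.isProbabilityMeasure_map hin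
  refine Measure.ext_of_Iic _ _ fun x => ?_
  rw [withDensity_fIn_Iic hτ hi hiU, ← h.measureReal_in_le hτ hi, ofReal_measureReal,
    Measure.map_apply_of_aemeasurable hin measurableSet_Iic]
  congr 1
  ext ω
  obtain ⟨a, -, hnth, -⟩ := exists_nthHighest_eq (s := fun a => G a ω) hi hiU
  simp [hnth]

lemma integral_precision {μ τ ρ c : ℝ} (h : IsBlockGaussian U G Q μ τ ρ c) (hτ : 0 < τ) :
    ∫ ω, precision #U (fun a => G a ω) U ∂Q = 1 / #U * ∑ i ∈ Icc 1 #U,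
      Q.real {ω | nthHighest Uᶜ (fun a => G a ω) (#U - i + 1) < nthHighest U (fun a => G a ω) i} := by
  have := h.gaussian.isProbabilityMeasure
  have hmeas : ∀ i ∈ Icc 1 #U, NullMeasurableSet
      {ω | nthHighest Uᶜ (fun a => G a ω) (#U - i + 1) < nthHighest U (fun a => G a ω) i} Q :=
    fun i hi => nullMeasurableSet_lt (h.aemeasurable_nthHighest _ (by omega))
      (h.aemeasurable_nthHighest _ (mem_Icc.1 hi).1)
  have hite : ∀ i, (fun ω => if nthHighest Uᶜ (fun a => G a ω) (#U - i + 1)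
      < nthHighest U (fun a => G a ω) i then (1 : ℝ) else 0) = Set.indicator
      {ω | nthHighest Uᶜ (fun a => G a ω) (#U - i + 1) < nthHighest U (fun a => G a ω) i}
      fun _ => 1 := by
    intro i
    ext ω
    simp [Set.indicator_apply]
  have hprec : (fun ω => precision #U (fun a => G a ω) U) =ᵐ[Q] fun ω => 1 / #U * ∑ i ∈ Icc 1 #U,
      if nthHighest Uᶜ (fun a => G a ω) (#U - i + 1) < nthHighest U (fun a => G a ω) i
        then (1 : ℝ) else 0 := by
    filter_upwards [h.ae_ne hτ] with ω hω
    exact precision_eq_sum rfl hω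
  rw [integral_congr_ae hprec, integral_const_mul, integral_finsetSum]
  · congr 1
    refine sum_congr rfl fun i hi => ?_
    rw [hite, integral_indicator₀ (hmeas i hi), setIntegral_const, smul_eq_mul, mul_one]
  · intro i hi
    rw [hite]
    exact (integrable_const 1).indicator₀ (hmeas i hi)

end IsBlockGaussian

lemma FOut_nonneg {N d k : ℕ} {σ : ℝ} (m : ℕ) (x : ℝ) : 0 ≤ FOut N d k σ m x := by
  rw [FOut_eq_binomialTail]
  have h0 := normalCDF_nonneg (μ := 0) (σ := sigmaOut d k σ) x
  have h1 := normalCDF_le_one (μ := 0) (σ := sigmaOut d k σ) x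
  exact sum_nonneg fun j _ => mul_nonneg (mul_nonneg (by positivity) (pow_nonneg h0 _))
    (pow_nonneg (by linarith) _)

end Consistency

end AverageEmbedding

end

/-! ### Assembly of the main theorem. -/

theorem proposition2 {Ω Ω' : Type*} [MeasurableSpace Ω] [MeasurableSpace Ω']
    (P : Measure Ω) [IsProbabilityMeasure P] (Q : Measure Ω') [IsProbabilityMeasure Q]
    (N d k : ℕ) (hd : 1 ≤ d) (hk : 2 ≤ k) (hkN : k ≤ N)
    -- the common law of the coordinates: finite moments, mean zero, standard deviation `σ > 0`
    (ν : Measure ℝ) [IsProbabilityMeasure ν] (hν : MemLp id 4 ν) (hmean : ∫ x, x ∂ν = 0)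
    (σ : ℝ) (hσ : 0 < σ) (hvar : Var[id; ν] = σ ^ 2)
    -- i.i.d. embeddings with i.i.d. coordinates
    (X : Fin N → Ω → EuclideanSpace ℝ (Fin d))
    (hX : iIndepFun X P) (hXcoord : ∀ i, iIndepFun (fun (j : Fin d) ω => X i ω j) P)
    (hXlaw : ∀ i j, HasLaw (fun ω => X i ω j) ν P)
    -- the approximating similarities
    (c : ℝ) (G : Finset (Fin N) → Fin N → Ω' → ℝ)
    (hG : ∀ U ∈ powersetCard k (univ : Finset (Fin N)),
      AverageEmbedding.IsNormalApprox X P U (G U) Q c) :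
    -- the combinatorial description of the precision, and the law of the out-set order statistics
    (∀ U ∈ powersetCard k (univ : Finset (Fin N)), ∀ i ∈ Icc 1 k,
      (∀ᵐ ω ∂Q, (i : ℝ) / k ≤ AverageEmbedding.precision k (fun a => G U a ω) U ↔
        AverageEmbedding.nthHighest Uᶜ (fun a => G U a ω) (k - i + 1)
          < AverageEmbedding.nthHighest U (fun a => G U a ω) i) ∧
      (∀ x : ℝ, Q.real {ω | AverageEmbedding.nthHighest Uᶜ (fun a => G U a ω) (k - i + 1) ≤ x}
        = AverageEmbedding.FOut N d k σ (k - i + 1) x)) ∧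
    -- the law of the in-set order statistics, and the consistency formula
    ∃ f : ℕ → ℝ → ℝ,
      (∀ i ∈ Icc 1 k, Measurable (f i) ∧ (∀ x, 0 ≤ f i x) ∧
        (∀ U ∈ powersetCard k (univ : Finset (Fin N)),
          Q.map (fun ω => (AverageEmbedding.nthHighest U (fun a => G U a ω) i).toReal)
            = volume.withDensity (fun x => ENNReal.ofReal (f i x))) ∧
        Integrable (fun x => f i x * AverageEmbedding.FOut N d k σ (k - i + 1) x)) ∧
      (c = 0 → ∀ i ∈ Icc 1 k, f i = AverageEmbedding.fIn d k σ (AverageEmbedding.kurtosis ν) i) ∧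
      AverageEmbedding.consistency k G Q
        = 1 / k * ∑ i ∈ Icc 1 k,
            ∫ x, f i x * AverageEmbedding.FOut N d k σ (k - i + 1) x := by
  open AverageEmbedding in
  have hN : 0 < N := by omega
  have hiid := IsCenteredIID.of_coordinates hν hmean hvar hX hXcoord hXlaw
  have hκ : 1 ≤ kurtosis ν := hiid.one_le_kurtosis hσ (⟨0, hN⟩, ⟨0, hd⟩)
  have hk2 : (2 : ℝ) ≤ k := by exact_mod_cast hk
  have hd1 : (1 : ℝ) ≤ d := by exact_mod_cast hd
  have hτ : 0 < sigmaIn d k σ (kurtosis ν) := by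
    have : 0 < kurtosis ν + k - 2 := by linarith
    unfold sigmaIn
    positivity
  have hρ : 0 < sigmaOut d k σ := by
    unfold sigmaOut
    positivity
  have hcard : ∀ U ∈ powersetCard k (univ : Finset (Fin N)), #U = k :=
    fun U hU => (mem_powersetCard.1 hU).2
  have hcompl : ∀ U ∈ powersetCard k (univ : Finset (Fin N)), #Uᶜ = N - k := fun U hU => by
    rw [card_compl, Fintype.card_fin, hcard U hU]
  have hblock : ∀ U ∈ powersetCard k (univ : Finset (Fin N)), IsBlockGaussian U (G U) Q
      (muIn d k σ) (sigmaIn d k σ (kurtosis ν)) (sigmaOut d k σ) c := fun U hU => by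
    have := (hG U hU).isBlockGaussian hiid hσ (by rw [hcard U hU]; linarith)
    rwa [hcard U hU] at this
  have hFOut : ∀ U ∈ powersetCard k (univ : Finset (Fin N)), ∀ m, 1 ≤ m → ∀ x : ℝ,
      Q.real {ω | nthHighest Uᶜ (fun a => G U a ω) m ≤ x} = FOut N d k σ m x := fun U hU m hm x => by
    rw [(hblock U hU).measureReal_out_le hρ hm, hcompl U hU, FOut_eq_binomialTail]
  refine ⟨fun U hU i hi => ⟨?_, hFOut U hU _ (by omega)⟩, ?_⟩
  · filter_upwards [(hblock U hU).ae_ne hτ] with ω hω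
    exact le_precision_iff (hcard U hU) hω hi
  obtain ⟨U₀, hU₀⟩ : (powersetCard k (univ : Finset (Fin N))).Nonempty :=
    powersetCard_nonempty.2 (by simpa)
  let inLaw : ℕ → Measure ℝ := fun i =>
    Q.map fun ω => (nthHighest U₀ (fun a => G U₀ a ω) i).toReal
  -- A density is unique only almost everywhere; the case split makes `f` equal the explicit formula
  -- at every point when `c = 0`. Otherwise a Radon–Nikodym derivative for the reference set `U₀`
  -- serves all `U`.
  let f : ℕ → ℝ → ℝ := fun i =>
    if c = 0 then fIn d k σ (kurtosis ν) i else fun x => ((inLaw i).rnDeriv volume x).toReal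
  have hfmeas : ∀ i, Measurable (f i) := fun i => by
    by_cases hc : c = 0
    · simpa only [f, if_pos hc] using continuous_fIn.measurable
    · simpa only [f, if_neg hc] using (Measure.measurable_rnDeriv _ _).ennreal_toReal
  have hf0 : ∀ i x, 0 ≤ f i x := fun i x => by
    by_cases hc : c = 0
    · simpa only [f, if_pos hc] using fIn_nonneg hτ x
    · simpa only [f, if_neg hc] using ENNReal.toReal_nonneg
  have hflaw : ∀ i ∈ Icc 1 k, ∀ U ∈ powersetCard k (univ : Finset (Fin N)),
      Q.map (fun ω => (nthHighest U (fun a => G U a ω) i).toReal)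
        = volume.withDensity (fun x => ENNReal.ofReal (f i x)) := by
    intro i hi U hU
    rw [mem_Icc] at hi
    rw [(hblock U hU).map_in_eq (hblock U₀ hU₀) (by rw [hcard U hU, hcard U₀ hU₀]) hi.1]
    have hiU := (hcard U₀ hU₀).symm ▸ hi.2
    have hb := hblock U₀ hU₀
    by_cases hc : c = 0
    · simp only [f, if_pos hc]
      rw [hc, ← hcard U₀ hU₀] at hb
      have := hb.map_in_eq_withDensity_fIn (by rwa [hcard U₀ hU₀]) hi.1 hiU
      rwa [hcard U₀ hU₀] at this
    · simp only [f, if_neg hc]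
      exact hb.map_in_eq_withDensity_rnDeriv hτ hi.1 hiU
  have hfint : ∀ i ∈ Icc 1 k, Integrable (f i) := by
    intro i hi
    have hprob : IsProbabilityMeasure (volume.withDensity fun x => ENNReal.ofReal (f i x)) := by
      rw [← hflaw i hi U₀ hU₀]
      exact Measure.isProbabilityMeasure_map
        ((hblock U₀ hU₀).aemeasurable_toReal_nthHighest U₀ (mem_Icc.1 hi).1)
    refine (lintegral_ofReal_ne_top_iff_integrable (hfmeas i).aestronglyMeasurable
      (Filter.Eventually.of_forall (hf0 i))).1 ?_
    rw [← setLIntegral_univ, ← withDensity_apply _ MeasurableSet.univ]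
    exact measure_ne_top _ _
  -- The bound is free once `FOut` is known to be a probability; it makes the product with the
  -- integrable density integrable.
  have hFle : ∀ m, 1 ≤ m → ∀ x, FOut N d k σ m x ≤ 1 := fun m hm x => by
    rw [← hFOut U₀ hU₀ m hm]
    exact measureReal_le_one
  refine ⟨f, fun i hi => ⟨hfmeas i, hf0 i, hflaw i hi, ?_⟩, fun hc i _ => if_pos hc, ?_⟩
  · refine (hfint i hi).mul_bdd (c := 1) (continuous_FOut _).aestronglyMeasurable
      (Filter.Eventually.of_forall fun x => ?_)
    rw [Real.norm_of_nonneg (FOut_nonneg _ _)]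
    exact hFle _ (by omega) x
  have hmean_prec : ∀ U ∈ powersetCard k (univ : Finset (Fin N)),
      ∫ ω, precision k (fun a => G U a ω) U ∂Q =
        1 / k * ∑ i ∈ Icc 1 k, ∫ x, f i x * FOut N d k σ (k - i + 1) x := by
    intro U hU
    have h := (hblock U hU).integral_precision hτ
    rw [hcard U hU] at h
    rw [h]
    congr 1
    refine sum_congr rfl fun i hi => ?_
    have hi' := mem_Icc.1 hi
    rw [(hblock U hU).measureReal_out_lt_in hτ hρ hi'.1 ((hcard U hU).symm ▸ hi'.2) (by omega),
      hflaw i hi U hU, hcompl U hU, integral_withDensity_eq_integral_toReal_smul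
        (hfmeas i).ennreal_ofReal (Filter.Eventually.of_forall fun x => ENNReal.ofReal_lt_top)]
    refine integral_congr_ae (Filter.Eventually.of_forall fun x => ?_)
    simp only [ENNReal.toReal_ofReal (hf0 i x), smul_eq_mul, FOut_eq_binomialTail]
  have hne : (#(powersetCard k (univ : Finset (Fin N))) : ℝ) ≠ 0 := by
    exact_mod_cast (card_pos.2 ⟨U₀, hU₀⟩).ne'
  -- Every `U` has the same expected precision, so averaging over `U` changes nothing.
  rw [consistency, sum_congr rfl hmean_prec, sum_const, nsmul_eq_mul, mul_div_cancel_left₀ _ hne]
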